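/- A modal algebra is a Boolean algebra with an additional unary operation $\Box$ satisfying $\Box 1 = 1$ and $\Box(x\wedge y)=\Box x\wedge\Box y$; write $\boxdot x := \Box x\wedge x$. Let $\mathcal{K}$ be the variety of all modal algebras (in the signature $\wedge,\vee,\neg,0,1,\Box$). A subvariety of $\mathcal{K}$ is weakly transitive if for some $n\in\mathbb{N}$ it satisfies the equation $\boxdot^{n+1}x\approx\boxdot^{n}x$. The canonical extension of a poset $P$ is the complete lattice $P^\sigma$, unique up to isomorphism over $P$, with an order embedding of $P$ that preserves all existing finite meets and joins, such that every element of $P^\sigma$ is a join of closed elements (meets of subsets of $P$) and a meet of open elements (joins of subsets of $P$), and such that for sets $X$ of closed and $Y$ of open elements, $\bigwedge X\le\bigvee Y$ if and only if $\bigwedge X_0\le\bigvee Y_0$ for some finite $X_0\subseteq X$, $Y_0\subseteq Y$. The canonical extension $\mathbf{A}^\sigma$ of a modal algebra $\mathbf{A}$ is the canonical extension of its underlying poset, each operation $f$ of $\mathbf{A}$ being extended (coordinatewise) by $f^\sigma(x)=\bigvee\{\bigwedge\{f(a) : a\in A^n,\ p\le a\le q\} : p \text{ closed},\ q\text{ open},\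 p\le x\le q\}$. A variety is closed under canonical extensions if it contains $\mathbf{A}^\sigma$ whenever it contains $\mathbf{A}$. A variety $\mathcal{V}$ is coherent if every finitely generated subalgebra of a finitely presented member of $\mathcal{V}$ is finitely presented in $\mathcal{V}$. It admits (right) uniform deductive interpolation if for all disjoint finite sets of variables $\bar x,\bar y$ and every finite set of equations $\Sigma(\bar x,\bar y)$ there is a finite set of equations $\Pi(\bar y)$ such that for every equation $\varepsilon(\bar y,\bar z)$, with $\bar z$ disjoint from $\bar x,\bar y$: $\Sigma\models_{\mathcal{V}}\varepsilon$ if and only if $\Pi\models_{\mathcal{V}}\varepsilon$. A theory $T^*$ is a model completion of a theory $T$ if every model of either theory embeds into a model of the other, every embedding between models of $T^*$ is elementary, and for every model $M$ of $T$ the theory $T^*\cup\mathrm{Diag}(M)$ is complete. **Corollary 5.4.** Let $\mathcal{V}$ be any subvariety of $\mathcal{K}$ that is closed under canonical extensions and not weakly transitive. Then $\mathcal{V}$ is not coherent, $\mathcal{V}$ does not admit (right) uniform deductive interpolation, and the first-order theory of $\mathcal{V}$ does not have a model completion. In particular, all three conclusions hold for $\mathcal{V}=\mathcal{K}$ (the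 variety of the modal logic $\mathbf{K}$) and for the variety of the modal logic $\mathbf{KT}$ (modal algebras satisfying $\Box x\le x$). -/

import Mathlib

universe u

namespace ModalCoherence

open FirstOrder FirstOrder.Language CategoryTheory

/-! ### Equations, consequence, coherence, uniform deductive interpolation -/

/-- An equation between two `L`-terms with variables in `α`. -/
abbrev Equation (L : FirstOrder.Language.{0, 0}) (α : Type) : Type := L.Term α × L.Term α

/-- The equation `e` is satisfied in `A` under the assignment `v` (that is, it lies in the kernel
of the homomorphism from the term algebra to `A` that extends `v`). -/
def Equation.Holds {L : FirstOrder.Language.{0, 0}} {α : Type} {A : Type u} [L.Structure A]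
    (e : Equation L α) (v : α → A) : Prop :=
  e.1.realize v = e.2.realize v

/-- Renaming the variables of an equation. -/
def Equation.rename {L : FirstOrder.Language.{0, 0}} {α β : Type} (g : α → β) (e : Equation L α) :
    Equation L β :=
  (e.1.relabel g, e.2.relabel g)

/-- Equational consequence `S ⊨_V e` in a class `V` of algebras. -/
def Entails {L : FirstOrder.Language.{0, 0}} (V : Set (Bundled.{u} L.Structure)) {α : Type}
    (S : Set (Equation L α)) (e : Equation L α) : Prop :=
  ∀ A ∈ V, ∀ v : α → A, (∀ s ∈ S, s.Holds v) → e.Holds v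

/-- `A` is presented in `V` by the generators `g 0, …, g (n - 1)` and the relations `R`, that is,
`A` is, via `g`, the quotient of the free algebra of `V` on `n` generators by the congruence that
`R` generates, expressed by the universal property of that quotient. -/
def IsPresentedBy {L : FirstOrder.Language.{0, 0}} (V : Set (Bundled.{u} L.Structure))
    (A : Bundled.{u} L.Structure) {n : ℕ} (g : Fin n → A) (R : Set (Equation L (Fin n))) : Prop :=
  A ∈ V ∧ (∀ r ∈ R, r.Holds g) ∧
    ∀ B ∈ V, ∀ v : Fin n → B, (∀ r ∈ R, r.Holds v) → ∃! h : A →[L] B, ∀ i, h (g i) = v i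

/-- `A` is a finitely presented member of `V`. -/
def IsFinitelyPresented {L : FirstOrder.Language.{0, 0}} (V : Set (Bundled.{u} L.Structure))
    (A : Bundled.{u} L.Structure) : Prop :=
  ∃ (n : ℕ) (g : Fin n → A) (R : Set (Equation L (Fin n))), R.Finite ∧ IsPresentedBy V A g R

/-- `V` is coherent: every finitely generated subalgebra of a finitely presented member of `V` is
itself finitely presented. -/
def IsCoherent {L : FirstOrder.Language.{0, 0}} (V : Set (Bundled.{u} L.Structure)) : Prop :=
  ∀ B : Bundled.{u} L.Structure, IsFinitelyPresented V B →
    ∀ S : L.Substructure B, S.FG → IsFinitelyPresented V (Bundled.of (c := L.Structure) S)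

/-- `V` admits right uniform deductive interpolation: for finite sets of variables `x̄` (of size
`l`) and `ȳ` (of size `m`) and each finite set `S(x̄, ȳ)` of equations there is a finite set
`P(ȳ)` of equations such that `S ⊨_V e ↔ P ⊨_V e` for every equation `e(ȳ, z̄)`. -/
def AdmitsRightUniformDeductiveInterpolation {L : FirstOrder.Language.{0, 0}}
    (V : Set (Bundled.{u} L.Structure)) : Prop :=
  ∀ (l m : ℕ) (S : Set (Equation L (Fin l ⊕ Fin m))), S.Finite →
    ∃ P : Set (Equation L (Fin m)), P.Finite ∧
      ∀ (k : ℕ) (e : Equation L (Fin m ⊕ Fin k)),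
        Entails V (α := Fin l ⊕ (Fin m ⊕ Fin k))
            (Equation.rename (Sum.map id Sum.inl) '' S) (Equation.rename Sum.inr e) ↔
          Entails V (Equation.rename Sum.inl '' P) e

/-! ### First-order theories and model completions -/

/-- The first-order theory of a class of structures. -/
def theoryOf {L : FirstOrder.Language.{0, 0}} (V : Set (Bundled.{u} L.Structure)) : L.Theory :=
  {φ | ∀ A ∈ V, A ⊨ φ}

/-- `T'` is a model completion of `T`: it is a model companion of `T` (every model of either theory
embeds into a model of the other one, and `T'` is model complete), and, for every model `M` of `T`,
`T'` together with the diagram of `M` is complete (models of the diagram of `M` are the same as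
structures with an embedding of `M`). -/
structure IsModelCompletion {L : FirstOrder.Language.{0, 0}} (T' T : L.Theory) : Prop where
  embeds : ∀ M : Theory.ModelType.{0, 0, u} T,
    ∃ N : Theory.ModelType.{0, 0, u} T', Nonempty (M ↪[L] N)
  embeds_base : ∀ N : Theory.ModelType.{0, 0, u} T',
    ∃ M : Theory.ModelType.{0, 0, u} T, Nonempty (N ↪[L] M)
  model_complete : ∀ (M N : Theory.ModelType.{0, 0, u} T') (f : M ↪[L] N) (n : ℕ)
    (φ : L.Formula (Fin n)) (v : Fin n → M), φ.Realize (f ∘ v) ↔ φ.Realize v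
  diagram_complete : ∀ (M : Theory.ModelType.{0, 0, u} T) (N₁ N₂ : Theory.ModelType.{0, 0, u} T')
    (f₁ : M ↪[L] N₁) (f₂ : M ↪[L] N₂) (n : ℕ) (φ : L.Formula (Fin n)) (v : Fin n → M),
    φ.Realize (f₁ ∘ v) ↔ φ.Realize (f₂ ∘ v)

/-- The theory `T` has a model completion. -/
def HasModelCompletion {L : FirstOrder.Language.{0, 0}} (T : L.Theory) : Prop :=
  ∃ T' : L.Theory, IsModelCompletion.{u} T' T

/-! ### Modal algebras -/

/-- The operation symbols of modal algebras. -/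
inductive ModalOp : ℕ → Type
  | bot : ModalOp 0
  | top : ModalOp 0
  | compl : ModalOp 1
  | box : ModalOp 1
  | inf : ModalOp 2
  | sup : ModalOp 2

/-- The signature `∧, ∨, ¬, 0, 1, □` of modal algebras. -/
def modalLang : FirstOrder.Language.{0, 0} := ⟨ModalOp, fun _ => Empty⟩

section Operations

variable {A : Type u} [modalLang.Structure A]

/-- The constant `0`. -/
def bot : A := Structure.funMap (L := modalLang) ModalOp.bot ![]

/-- The constant `1`. -/
def top : A := Structure.funMap (L := modalLang) ModalOp.top ![]

/-- The operation `¬`. -/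
def compl (a : A) : A := Structure.funMap (L := modalLang) ModalOp.compl ![a]

/-- The operation `□`. -/
def box (a : A) : A := Structure.funMap (L := modalLang) ModalOp.box ![a]

/-- The operation `∧`. -/
def inf (a b : A) : A := Structure.funMap (L := modalLang) ModalOp.inf ![a, b]

/-- The operation `∨`. -/
def sup (a b : A) : A := Structure.funMap (L := modalLang) ModalOp.sup ![a, b]

/-- The term operation `□x ∧ x`. -/
def boxdot (a : A) : A := inf (box a) a

end Operations

/-- The identities defining modal algebras: Boolean algebras with a unary operation `□` that
preserves finite meets (including the empty one). -/
structure IsModalAlgebra (A : Type u) [modalLang.Structure A] : Prop where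
  inf_comm : ∀ a b : A, inf a b = inf b a
  inf_assoc : ∀ a b c : A, inf (inf a b) c = inf a (inf b c)
  sup_comm : ∀ a b : A, sup a b = sup b a
  sup_assoc : ∀ a b c : A, sup (sup a b) c = sup a (sup b c)
  inf_sup_self : ∀ a b : A, inf a (sup a b) = a
  sup_inf_self : ∀ a b : A, sup a (inf a b) = a
  inf_sup_left : ∀ a b c : A, inf a (sup b c) = sup (inf a b) (inf a c)
  sup_bot : ∀ a : A, sup a bot = a
  inf_top : ∀ a : A, inf a top = a
  inf_compl : ∀ a : A, inf a (compl a) = bot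
  sup_compl : ∀ a : A, sup a (compl a) = top
  box_top : box (top : A) = top
  box_inf : ∀ a b : A, box (inf a b) = inf (box a) (box b)

/-- The variety of all modal algebras. -/
def varietyK : Set (Bundled.{u} modalLang.Structure) := {A | IsModalAlgebra A}

/-- The variety of the modal logic **KT**: modal algebras with `□x ≤ x`. -/
def varietyKT : Set (Bundled.{u} modalLang.Structure) :=
  {A | IsModalAlgebra A ∧ ∀ a : A, inf (box a) a = box a}

/-- `V` is a variety of modal algebras, that is, the class of all modal algebras satisfying some
set `E` of equations. -/
def IsModalVariety (V : Set (Bundled.{u} modalLang.Structure)) : Prop :=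
  ∃ E : Set (Equation modalLang ℕ),
    V = {A : Bundled.{u} modalLang.Structure | IsModalAlgebra A ∧ ∀ e ∈ E, ∀ v : ℕ → A, e.Holds v}

/-- `V` is weakly transitive: for some `n` it satisfies `⊡ⁿ⁺¹x ≈ ⊡ⁿx`, where `⊡x` is `□x ∧ x`. -/
def IsWeaklyTransitive (V : Set (Bundled.{u} modalLang.Structure)) : Prop :=
  ∃ n : ℕ, ∀ A ∈ V, ∀ a : A, boxdot^[n + 1] a = boxdot^[n] a

/-- The Boolean order `a ≤ b ↔ a ∧ b = a` of a modal algebra. -/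
@[reducible]
def IsModalAlgebra.toPartialOrder {A : Type u} [modalLang.Structure A] (h : IsModalAlgebra A) :
    PartialOrder A where
  le a b := inf a b = a
  le_refl a := by
    have h1 := h.inf_sup_self a (inf a a)
    rwa [h.sup_inf_self] at h1
  le_trans a b c hab hbc := by
    have hab' : inf a b = a := hab
    have hbc' : inf b c = b := hbc
    rw [← hab', h.inf_assoc, hbc']
  le_antisymm a b hab hba := by
    have hab' : inf a b = a := hab
    have hba' : inf b a = b := hba
    rw [← hab', h.inf_comm, hba']

/-! ### Canonical extensions -/

section Completions

variable {P : Type u} {C : Type u} [CompleteLattice C]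

/-- Closed elements of a completion: meets of elements of the image of `P`. -/
def IsClosedElt (e : P → C) (c : C) : Prop := ∃ X : Set P, c = sInf (e '' X)

/-- Open elements of a completion: joins of elements of the image of `P`. -/
def IsOpenElt (e : P → C) (c : C) : Prop := ∃ X : Set P, c = sSup (e '' X)

/-- `e : P → C` is a canonical extension of the poset `P`: an order embedding into a complete
lattice that preserves all existing finite meets and joins and is dense and compact. -/
structure IsCanonicalExtension [PartialOrder P] (e : P → C) : Prop where
  le_iff_le : ∀ a b : P, e a ≤ e b ↔ a ≤ b
  map_isGLB : ∀ (S : Set P) (a : P), S.Finite → IsGLB S a → IsGLB (e '' S) (e a)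
  map_isLUB : ∀ (S : Set P) (a : P), S.Finite → IsLUB S a → IsLUB (e '' S) (e a)
  dense_closed : ∀ c : C, ∃ X : Set C, (∀ p ∈ X, IsClosedElt e p) ∧ c = sSup X
  dense_open : ∀ c : C, ∃ Y : Set C, (∀ q ∈ Y, IsOpenElt e q) ∧ c = sInf Y
  compact : ∀ X Y : Set C, (∀ p ∈ X, IsClosedElt e p) → (∀ q ∈ Y, IsOpenElt e q) →
    (sInf X ≤ sSup Y ↔
      ∃ X₀ ⊆ X, ∃ Y₀ ⊆ Y, X₀.Finite ∧ Y₀.Finite ∧ sInf X₀ ≤ sSup Y₀)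

/-- The extension `f^σ` of an `n`-ary operation `f` on `P`; closed and open elements of
`Cⁿ` are the tuples of closed and open elements:
`f^σ(x) = ⋁ {⋀ {f(a) | a ∈ Pⁿ, p ≤ a ≤ q} | p closed, q open, p ≤ x ≤ q}`. -/
def sigmaExt (e : P → C) {n : ℕ} (f : (Fin n → P) → P) (x : Fin n → C) : C :=
  sSup {y | ∃ p q : Fin n → C, (∀ i, IsClosedElt e (p i)) ∧ (∀ i, IsOpenElt e (q i)) ∧
    p ≤ x ∧ x ≤ q ∧ y = sInf {z | ∃ a : Fin n → P, p ≤ e ∘ a ∧ e ∘ a ≤ q ∧ z = e (f a)}}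

/-- The algebra on `C` whose operations are the `σ`-extensions of the operations of `P`. -/
@[reducible]
def sigmaStructure [modalLang.Structure P] (e : P → C) : modalLang.Structure C where
  funMap f x := sigmaExt e (Structure.funMap f) x
  RelMap r _ := Empty.elim r

end Completions

/-- `V` is closed under canonical extensions: `A^σ` belongs to `V` for every `A` in `V`, where `A^σ`
is the canonical extension of the poset reduct of `A` (it is unique up to isomorphism), equipped
with the extensions of the operations of `A`. -/
def ClosedUnderCanonicalExtensions (V : Set (Bundled.{u} modalLang.Structure)) : Prop :=
  ∀ A ∈ V, ∀ h : IsModalAlgebra A,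
    ∃ (C : Type u) (_ : CompleteLattice C) (e : A → C),
      @IsCanonicalExtension A C _ h.toPartialOrder e ∧
        (⟨C, sigmaStructure e⟩ : Bundled.{u} modalLang.Structure) ∈ V

end ModalCoherence

/-! Consider the finite system saying that `x` is a fixpoint of `⊡` with `y ≤ x ≤ z`. It forces `y ≤
⊡ᵏ z` for every `k`, because `x = ⊡ᵏ x ≤ ⊡ᵏ z`. Conversely, when `y ≤ ⊡ᵏ z` holds for all `k`, the
meet of all `⊡ᵏ z` in the canonical extension is such a fixpoint (`HasFixpointExtensions`). So the
consequences of the system in `y, z` are axiomatised by the infinite descending list of conditions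
`y ≤ ⊡ᵏ z`.

If they had a finite axiomatisation, compactness would derive it from the conditions with `k ≤ n`,
and these would then imply `y ≤ ⊡ⁿ⁺¹ z`. Taking `y = ⊡ⁿ z` gives weak transitivity
(`isWeaklyTransitive_of_finite`). Coherence and uniform deductive interpolation each supply such a
finite axiomatisation. In a model completion, the existence of a fixpoint would be a first-order
formula equivalent to the whole infinite list, which an ultraproduct refutes.

For K and KT the fixpoint is built instead in the complex algebra of the ultrafilter frame, where
box commutes with arbitrary intersections. Weak transitivity fails in the complex algebra of a
reflexive frame on `ℕ`. -/

namespace ModalCoherence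

open FirstOrder FirstOrder.Language CategoryTheory

/-! ### Equational classes, ultraproducts and compactness of consequence -/

section UniversalAlgebra

variable {L : FirstOrder.Language.{0, 0}} {α β : Type}

@[simp]
theorem Equation.holds_rename {A : Type u} [L.Structure A] (g : α → β) (e : Equation L α)
    (v : β → A) : (e.rename g).Holds v ↔ e.Holds (v ∘ g) := by
  simp [Equation.Holds, Equation.rename]

/-- Substituting terms for the variables of an equation. -/
def Equation.subst (e : Equation L α) (s : α → L.Term β) : Equation L β :=
  (e.1.subst s, e.2.subst s)

@[simp]
theorem Equation.holds_subst {A : Type u} [L.Structure A] (e : Equation L α) (s : α → L.Term β)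
    (v : β → A) : (e.subst s).Holds v ↔ e.Holds (fun i => (s i).realize v) := by
  simp [Equation.Holds, Equation.subst]

theorem Equation.Holds.map {A B : Type u} [L.Structure A] [L.Structure B] {e : Equation L α}
    {v : α → A} (h : e.Holds v) (f : A →[L] B) : e.Holds (f ∘ v) := by
  have h' : e.1.realize v = e.2.realize v := h
  simp [Equation.Holds, HomClass.realize_term, h']

theorem Equation.holds_comp_iff {A B F : Type*} [L.Structure A] [L.Structure B] [FunLike F A B]
    [HomClass L F A B] {e : Equation L α} {v : α → A} (f : F) (hf : Function.Injective f) :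
    e.Holds (f ∘ v) ↔ e.Holds v := by
  simp [Equation.Holds, HomClass.realize_term, hf.eq_iff]

/-- The class of all algebras satisfying the equations `E`. -/
def equationalClass (E : Set (Equation L ℕ)) : Set (Bundled.{u} L.Structure) :=
  {A | ∀ e ∈ E, ∀ v : ℕ → A, e.Holds v}

/-- The universal closure of an equation. -/
noncomputable def Equation.sentence (e : Equation L ℕ) : L.Sentence :=
  Formula.iAlls {n : ℕ // n ∈ e.1.varFinset ∪ e.2.varFinset}
    (Term.equal
      ((e.1.restrictVar fun i => (⟨i.1, Finset.mem_union_left _ i.2⟩ :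
        {n : ℕ // n ∈ e.1.varFinset ∪ e.2.varFinset})).relabel Sum.inr)
      ((e.2.restrictVar fun i => (⟨i.1, Finset.mem_union_right _ i.2⟩ :
        {n : ℕ // n ∈ e.1.varFinset ∪ e.2.varFinset})).relabel Sum.inr))

theorem Equation.realize_sentence {A : Type u} [L.Structure A] [Nonempty A] (e : Equation L ℕ) :
    A ⊨ e.sentence ↔ ∀ v : ℕ → A, e.Holds v := by
  rw [Sentence.Realize, Equation.sentence, Formula.realize_iAlls]
  simp only [Formula.realize_equal, Term.realize_relabel]
  constructor
  · intro h v
    have h1 := h fun i => v i.1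
    rwa [Term.realize_restrictVar v (by intro i; rfl),
      Term.realize_restrictVar v (by intro i; rfl)] at h1
  · intro h w
    classical
    -- The sentence quantifies only over the variables that occur, so the remaining ones get an
    -- arbitrary value; this is where nonemptiness is needed.
    let v : ℕ → A := fun n =>
      if hn : n ∈ e.1.varFinset ∪ e.2.varFinset then w ⟨n, hn⟩ else Classical.arbitrary A
    have hv : ∀ i : {n : ℕ // n ∈ e.1.varFinset ∪ e.2.varFinset}, w i = v i.1 := by
      intro i
      simp only [v, dif_pos i.2]
    rw [Term.realize_restrictVar v (by intro i; exact hv _),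
      Term.realize_restrictVar v (by intro i; exact hv _)]
    exact h v

theorem mem_equationalClass_of_models {E : Set (Equation L ℕ)} {A : Type u} [L.Structure A]
    [Nonempty A] (h : A ⊨ theoryOf (equationalClass.{u} E))
    (hne : ∀ B ∈ equationalClass.{u} E, Nonempty B) :
    Bundled.of (c := L.Structure) A ∈ equationalClass.{u} E := by
  intro e he
  refine (Equation.realize_sentence (A := A) e).1 (h.realize_of_mem _ ?_)
  intro B hB
  have := hne B hB
  exact (Equation.realize_sentence e).2 (hB e he)

theorem models_theoryOf {V : Set (Bundled.{u} L.Structure)} {A : Bundled.{u} L.Structure}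
    (hA : A ∈ V) : A ⊨ theoryOf V :=
  ⟨fun _ hφ => hφ A hA⟩

theorem Equation.holds_ultraproduct {ι : Type} {M : ι → Type u} [∀ i, L.Structure (M i)]
    (U : Ultrafilter ι) (e : Equation L α) (x : α → ∀ i, M i) :
    e.Holds (fun a => (x a : (U : Filter ι).Product M)) ↔ ∀ᶠ i in U, e.Holds fun a => x a i := by
  unfold Equation.Holds
  rw [Ultraproduct.term_realize_cast, Ultraproduct.term_realize_cast]
  exact Quotient.eq''

theorem ultraproduct_mem_equationalClass {E : Set (Equation L ℕ)} {ι : Type}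
    (A : ι → Bundled.{u} L.Structure) (hA : ∀ i, A i ∈ equationalClass E) (U : Ultrafilter ι) :
    Bundled.of (c := L.Structure) ((U : Filter ι).Product fun i => A i) ∈ equationalClass E := by
  intro e he v
  choose x hx using fun n => Quotient.exists_rep (v n)
  obtain rfl : (fun n => Quotient.mk _ (x n)) = v := funext hx
  exact (Equation.holds_ultraproduct U e x).2 (Filter.Eventually.of_forall fun i => hA i e he _)

/-- Compactness of equational consequence in an equational class. -/
theorem exists_bound_of_entails {E : Set (Equation L ℕ)} (s : ℕ → Equation L α)
    {P : Set (Equation L α)} (hP : P.Finite)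
    (h : ∀ r ∈ P, Entails (equationalClass.{u} E) (Set.range s) r) :
    ∃ n, ∀ A ∈ equationalClass.{u} E, ∀ v : α → A, (∀ k ≤ n, (s k).Holds v) →
      ∀ r ∈ P, r.Holds v := by
  -- Counterexamples for each `n` are glued into an ultraproduct over a nonprincipal ultrafilter,
  -- which satisfies every `s k`.
  by_contra! hcon
  choose A hA v hv r hr hrv using hcon
  let U : Ultrafilter ℕ := Filter.hyperfilter ℕ
  let x : α → ∀ n, A n := fun a n => v n a
  have hN := ultraproduct_mem_equationalClass A hA U
  have hs : ∀ e ∈ Set.range s, e.Holds fun a => (x a : (U : Filter ℕ).Product fun n => A n) := by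
    rintro _ ⟨k, rfl⟩
    rw [Equation.holds_ultraproduct]
    have : ∀ᶠ n in (U : Filter ℕ), k ≤ n :=
      Nat.hyperfilter_le_atTop (Filter.eventually_ge_atTop k)
    exact this.mono fun n hn => hv n k hn
  -- Finiteness of `P` puts all its equations on one common large set of indices.
  have hall : ∀ᶠ n in (U : Filter ℕ), ∀ e ∈ P, e.Holds fun a => x a n := by
    rw [Filter.eventually_all_finite hP]
    intro e he
    exact (Equation.holds_ultraproduct U e x).1 (h e he _ hN _ hs)
  obtain ⟨n, hn⟩ := hall.exists
  exact hrv n (hn _ (hr n))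

/-! ### Algebras presented by generators and relations -/

/-- Provable equality of terms under the relations `S`. -/
def termSetoid (V : Set (Bundled.{u} L.Structure)) (S : Set (Equation L α)) :
    Setoid (L.Term α) where
  r s t := Entails V S (s, t)
  iseqv :=
    { refl := fun _ _ _ _ _ => rfl
      symm := fun h A hA v hv => (h A hA v hv).symm
      trans := fun h₁ h₂ A hA v hv => (h₁ A hA v hv).trans (h₂ A hA v hv) }

/-- The algebra with generators `α` and relations `S` in the class `V`. -/
def PresentedAlgebra (V : Set (Bundled.{u} L.Structure)) (S : Set (Equation L α)) : Type u :=
  -- Terms live in `Type`, the members of `V` in `Type u`.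
  ULift.{u} (Quotient (termSetoid V S))

namespace PresentedAlgebra

variable {V : Set (Bundled.{u} L.Structure)} {S : Set (Equation L α)}

/-- The element denoted by a term. -/
def mk (V : Set (Bundled.{u} L.Structure)) (S : Set (Equation L α)) (t : L.Term α) :
    PresentedAlgebra V S :=
  ⟨Quotient.mk _ t⟩

theorem mk_eq_mk {s t : L.Term α} : mk V S s = mk V S t ↔ Entails V S (s, t) := by
  refine ⟨fun h => Quotient.exact (congrArg ULift.down h), fun h => ?_⟩
  exact congrArg ULift.up (Quotient.sound h)

/-- A term denoting a given element. -/
noncomputable def out (a : PresentedAlgebra V S) : L.Term α := Quotient.out a.down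

@[simp]
theorem mk_out (a : PresentedAlgebra V S) : mk V S a.out = a :=
  congrArg ULift.up (Quotient.out_eq a.down)

/-- Empty relations let `lift` preserve relations vacuously; equational classes do not constrain
them. -/
noncomputable instance : L.Structure (PresentedAlgebra V S) where
  funMap f x := mk V S (Term.func f fun i => (x i).out)
  RelMap _ _ := False

theorem entails_out_mk (t : L.Term α) : Entails V S ((mk V S t).out, t) :=
  mk_eq_mk.1 (mk_out _)

theorem realize_mk (s : β → L.Term α) (t : L.Term β) :
    t.realize (fun i => mk V S (s i)) = mk V S (t.subst s) := by
  induction t with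
  | var => rfl
  | func f ts ih =>
    refine mk_eq_mk.2 fun A hA v hv => ?_
    simp only [Equation.Holds, Term.realize_func, Term.subst]
    congr 1
    funext i
    rw [ih i]
    exact entails_out_mk _ A hA v hv

theorem holds_mk (s : β → L.Term α) (e : Equation L β) :
    e.Holds (fun i => mk V S (s i)) ↔ Entails V S (e.subst s) := by
  rw [Equation.Holds, realize_mk, realize_mk, mk_eq_mk]
  rfl

theorem holds_var (e : Equation L α) :
    e.Holds (fun i => mk V S (Term.var i)) ↔ Entails V S e := by
  rw [holds_mk]
  simp [Entails]

/-- Every assignment is represented by terms, so an equation of `E` becomes one of its substitution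
instances, which is valid throughout the class. -/
theorem mem_equationalClass (E : Set (Equation L ℕ)) :
    Bundled.of (c := L.Structure) (PresentedAlgebra (equationalClass.{u} E) S) ∈
      equationalClass.{u} E := by
  intro e he v
  have hv : (fun n => mk _ S (out (v n))) = v := funext fun n => mk_out _
  rw [← hv]
  refine (holds_mk (fun n => out (v n)) e).2 fun A hA w _ => ?_
  rw [Equation.holds_subst]
  exact hA e he _

/-- The homomorphism given by values of the generators that satisfy the relations. -/
noncomputable def lift {B : Bundled.{u} L.Structure} (hB : B ∈ V) (v : α → B)
    (hv : ∀ r ∈ S, r.Holds v) : PresentedAlgebra V S →[L] B where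
  toFun a := a.out.realize v
  map_fun' _ _ := entails_out_mk _ B hB v hv
  map_rel' _ _ h := h.elim

theorem isPresentedBy (E : Set (Equation L ℕ)) {n : ℕ} (S : Set (Equation L (Fin n))) :
    IsPresentedBy (equationalClass.{u} E)
      (Bundled.of (c := L.Structure) (PresentedAlgebra (equationalClass.{u} E) S))
      (fun i => mk _ S (Term.var i)) S := by
  refine ⟨mem_equationalClass E, fun r hr => (holds_var r).2 fun _ _ _ hv => hv r hr, ?_⟩
  intro B hB v hv
  refine ⟨lift hB v hv, fun i => entails_out_mk _ B hB v hv, fun h hh => ?_⟩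
  ext a
  change h a = a.out.realize v
  conv_lhs => rw [← mk_out a]
  have h1 := realize_mk (V := equationalClass.{u} E) (S := S) Term.var a.out
  have h2 : a.out.subst Term.var = a.out := by
    induction a.out with
    | var => rfl
    | func f ts ih => simp only [Term.subst, ih]
  rw [h2] at h1
  rw [← h1]
  refine (HomClass.realize_term h).symm.trans ?_
  congr 1
  funext i
  exact hh i

end PresentedAlgebra

/-! ### Finite axiomatisation of the consequences in some of the variables -/

theorem mem_closure_range_iff {A : Type u} [L.Structure A] {ι : Type} (y : ι → A) (x : A) :
    x ∈ Substructure.closure L (Set.range y) ↔ ∃ t : L.Term ι, t.realize y = x := by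
  rw [Substructure.mem_closure_iff_exists_term]
  constructor
  · rintro ⟨t, rfl⟩
    choose c hc using fun a : Set.range y => a.2
    refine ⟨t.relabel c, ?_⟩
    rw [Term.realize_relabel]
    congr 1
    funext a
    exact hc a
  · rintro ⟨t, rfl⟩
    refine ⟨t.relabel fun i => ⟨y i, i, rfl⟩, ?_⟩
    rw [Term.realize_relabel]
    rfl

theorem substructure_mem_equationalClass {E : Set (Equation L ℕ)} {A : Bundled.{u} L.Structure}
    (hA : A ∈ equationalClass E) (S : L.Substructure A) :
    Bundled.of (c := L.Structure) S ∈ equationalClass E := by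
  intro e he v
  exact (Equation.holds_comp_iff (v := v) S.subtype Subtype.val_injective).1 (hA e he _)

/-- The generators of a presentation generate. -/
theorem IsPresentedBy.closure_eq_top {E : Set (Equation L ℕ)} {A : Bundled.{u} L.Structure} {n : ℕ}
    {g : Fin n → A} {R : Set (Equation L (Fin n))}
    (h : IsPresentedBy (equationalClass E) A g R) :
    Substructure.closure L (Set.range g) = ⊤ := by
  obtain ⟨hA, hR, huniv⟩ := h
  set S := Substructure.closure L (Set.range g) with hS
  have hg : ∀ i, g i ∈ S := fun i => Substructure.subset_closure ⟨i, rfl⟩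
  let g' : Fin n → S := fun i => ⟨g i, hg i⟩
  obtain ⟨f, hf, -⟩ := huniv (Bundled.of (c := L.Structure) S)
    (substructure_mem_equationalClass hA S) g' fun r hr =>
      (Equation.holds_comp_iff (v := g') S.subtype Subtype.val_injective).1 (hR r hr)
  obtain ⟨_, _, huniq⟩ := huniv A hA g hR
  -- `f` followed by the inclusion fixes the generators, hence is the identity, so every element
  -- lies in `S`.
  have h1 := huniq (S.subtype.toHom.comp f) fun i => congrArg Subtype.val (hf i)
  have h2 := huniq (Hom.id L A) fun i => rfl
  rw [eq_top_iff]
  intro a _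
  have h3 : (S.subtype.toHom.comp f) a = a := by rw [h1, ← h2]; rfl
  rw [← h3]
  exact (f a).2

/-- In a coherent equational class the consequences, in some of the variables, of a finite set of
equations are the consequences of a finite set of equations in these variables. -/
theorem IsCoherent.exists_finite_entails_iff {E : Set (Equation L ℕ)}
    (hE : IsCoherent (equationalClass.{u} E)) {n m : ℕ} {S : Set (Equation L (Fin n))}
    (hS : S.Finite) (f : Fin m → Fin n) :
    ∃ P : Set (Equation L (Fin m)), P.Finite ∧ ∀ e : Equation L (Fin m),
      Entails (equationalClass.{u} E) S (e.rename f) ↔ Entails (equationalClass.{u} E) P e := by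
  set V := equationalClass.{u} E
  let B : Bundled.{u} L.Structure := Bundled.of (c := L.Structure) (PresentedAlgebra V S)
  have hB : IsPresentedBy V B (fun i => PresentedAlgebra.mk V S (Term.var i)) S :=
    PresentedAlgebra.isPresentedBy E S
  let y : Fin m → B := fun j => PresentedAlgebra.mk V S (Term.var (f j))
  let C := Substructure.closure L (Set.range y)
  obtain ⟨k, g, R, hR, hpres⟩ := hE B ⟨n, _, S, hS, hB⟩ C
    (Substructure.fg_closure (Set.finite_range y))
  let yC : Fin m → C := fun j => ⟨y j, Substructure.subset_closure ⟨j, rfl⟩⟩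
  have hyC : ∀ e : Equation L (Fin m), Entails V S (e.rename f) ↔ e.Holds yC := by
    intro e
    rw [← PresentedAlgebra.holds_var, Equation.holds_rename]
    exact Equation.holds_comp_iff (v := yC) C.subtype Subtype.val_injective
  have ht : ∀ i, ∃ t : L.Term (Fin m), t.realize yC = g i := by
    intro i
    obtain ⟨t, ht⟩ := (mem_closure_range_iff y _).1 (g i).2
    refine ⟨t, Subtype.val_injective ?_⟩
    rw [← ht]
    exact (HomClass.realize_term C.subtype (v := yC)).symm
  choose t ht using ht
  have hs : ∀ j, ∃ s : L.Term (Fin k), s.realize g = yC j := by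
    intro j
    refine (mem_closure_range_iff g _).1 ?_
    rw [hpres.closure_eq_top]
    trivial
  choose s hs using hs
  obtain ⟨hC, hRg, huniv⟩ := hpres
  -- A change of generators: `t` writes `g` in terms of `y` and `s` writes `y` in terms of `g`. The
  -- new relations are those of `R` rewritten by `t`, together with `y j = s j (t y)`.
  refine ⟨(fun r => r.subst t) '' R ∪ Set.range fun j => (Term.var j, (s j).subst t),
    (hR.image _).union (Set.finite_range _), fun e => ⟨fun he A hA v hv => ?_, fun he => ?_⟩⟩
  · obtain ⟨h, hh, -⟩ := huniv A hA (fun i => (t i).realize v) fun r hr =>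
      (Equation.holds_subst r t v).1 (hv _ (Or.inl ⟨r, hr, rfl⟩))
    have hyv : h ∘ yC = v := by
      funext j
      have h1 : v j = ((s j).subst t).realize v := hv _ (Or.inr ⟨j, rfl⟩)
      rw [h1, Term.realize_subst]
      refine (congrArg h (hs j)).symm.trans ((HomClass.realize_term h).symm.trans ?_)
      congr 1
      funext i
      exact hh i
    rw [← hyv]
    exact ((hyC e).1 he).map (B := A) h
  · rw [hyC]
    refine he _ hC yC ?_
    rintro _ (⟨r, hr, rfl⟩ | ⟨j, rfl⟩)
    · refine (Equation.holds_subst r t yC).2 ?_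
      simp only [ht]
      exact hRg r hr
    · change yC j = ((s j).subst t).realize yC
      rw [Term.realize_subst]
      simp only [ht]
      exact (hs j).symm

/-- Uniform deductive interpolation, without side variables. -/
theorem AdmitsRightUniformDeductiveInterpolation.exists_finite_entails_iff
    {V : Set (Bundled.{u} L.Structure)} (hV : AdmitsRightUniformDeductiveInterpolation V)
    {l m : ℕ} {S : Set (Equation L (Fin l ⊕ Fin m))} (hS : S.Finite) :
    ∃ P : Set (Equation L (Fin m)), P.Finite ∧ ∀ e : Equation L (Fin m),
      Entails V S (e.rename Sum.inr) ↔ Entails V P e := by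
  obtain ⟨P, hP, h⟩ := hV l m S hS
  refine ⟨P, hP, fun e => ?_⟩
  -- The block `z̄` is taken empty.
  have key := h 0 (e.rename Sum.inl)
  have h1 : Entails V (Equation.rename (Sum.map id Sum.inl : Fin l ⊕ Fin m → _) '' S)
      (Equation.rename Sum.inr (e.rename (Sum.inl : Fin m → Fin m ⊕ Fin 0))) ↔
      Entails V S (e.rename Sum.inr) := by
    constructor
    · intro H A hA v hv
      have := H A hA (Sum.elim (v ∘ Sum.inl) (Sum.elim (v ∘ Sum.inr) Fin.elim0)) (by
        rintro _ ⟨s, hs, rfl⟩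
        rw [Equation.holds_rename]
        convert hv s hs using 1
        funext i
        cases i <;> rfl)
      simpa [Function.comp_def] using this
    · intro H A hA v hv
      have := H A hA (v ∘ Sum.map id Sum.inl) fun s hs => by
        rw [← Equation.holds_rename]
        exact hv _ ⟨s, hs, rfl⟩
      simpa [Function.comp_def] using this
  have h2 : Entails V (Equation.rename Sum.inl '' P) (e.rename (Sum.inl : Fin m → Fin m ⊕ Fin 0)) ↔
      Entails V P e := by
    constructor
    · intro H A hA v hv
      have := H A hA (Sum.elim v Fin.elim0) (by
        rintro _ ⟨s, hs, rfl⟩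
        rw [Equation.holds_rename]
        exact hv s hs)
      rwa [Equation.holds_rename] at this
    · intro H A hA v hv
      rw [Equation.holds_rename]
      exact H A hA _ fun s hs => by
        rw [← Equation.holds_rename]
        exact hv _ ⟨s, hs, rfl⟩
  rw [← h1, key, h2]

end UniversalAlgebra

/-! ### Terms and equations of modal algebras -/

section ModalTerms

variable {α : Type}

/-- The term `0`. -/
def botTerm : modalLang.Term α := Term.func (L := modalLang) ModalOp.bot ![]

/-- The term `1`. -/
def topTerm : modalLang.Term α := Term.func (L := modalLang) ModalOp.top ![]

/-- The term `¬ s`. -/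
def complTerm (s : modalLang.Term α) : modalLang.Term α :=
  Term.func (L := modalLang) ModalOp.compl ![s]

/-- The term `□ s`. -/
def boxTerm (s : modalLang.Term α) : modalLang.Term α :=
  Term.func (L := modalLang) ModalOp.box ![s]

/-- The term `s ∧ t`. -/
def infTerm (s t : modalLang.Term α) : modalLang.Term α :=
  Term.func (L := modalLang) ModalOp.inf ![s, t]

/-- The term `s ∨ t`. -/
def supTerm (s t : modalLang.Term α) : modalLang.Term α :=
  Term.func (L := modalLang) ModalOp.sup ![s, t]

/-- The term `□ s ∧ s`. -/
def boxdotTerm (s : modalLang.Term α) : modalLang.Term α := infTerm (boxTerm s) s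

variable {A : Type u} [modalLang.Structure A] (v : α → A) (s t : modalLang.Term α)

@[simp]
theorem realize_botTerm : (botTerm : modalLang.Term α).realize v = bot := by
  refine congrArg (Structure.funMap (L := modalLang) ModalOp.bot) (funext fun i => ?_)
  exact i.elim0

@[simp]
theorem realize_topTerm : (topTerm : modalLang.Term α).realize v = top := by
  refine congrArg (Structure.funMap (L := modalLang) ModalOp.top) (funext fun i => ?_)
  exact i.elim0

@[simp]
theorem realize_complTerm : (complTerm s).realize v = compl (s.realize v) := by
  refine congrArg (Structure.funMap (L := modalLang) ModalOp.compl) (funext fun i => ?_)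
  fin_cases i
  rfl

@[simp]
theorem realize_boxTerm : (boxTerm s).realize v = box (s.realize v) := by
  refine congrArg (Structure.funMap (L := modalLang) ModalOp.box) (funext fun i => ?_)
  fin_cases i
  rfl

@[simp]
theorem realize_infTerm : (infTerm s t).realize v = inf (s.realize v) (t.realize v) := by
  refine congrArg (Structure.funMap (L := modalLang) ModalOp.inf) (funext fun i => ?_)
  fin_cases i <;> rfl

@[simp]
theorem realize_supTerm : (supTerm s t).realize v = sup (s.realize v) (t.realize v) := by
  refine congrArg (Structure.funMap (L := modalLang) ModalOp.sup) (funext fun i => ?_)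
  fin_cases i <;> rfl

@[simp]
theorem realize_boxdotTerm : (boxdotTerm s).realize v = boxdot (s.realize v) := by
  simp [boxdotTerm, boxdot]

@[simp]
theorem realize_iterate_boxdotTerm (k : ℕ) :
    (boxdotTerm^[k] s).realize v = boxdot^[k] (s.realize v) := by
  induction k with
  | zero => rfl
  | succ k ih => simp only [Function.iterate_succ_apply', realize_boxdotTerm, ih]

variable {B F : Type*} [modalLang.Structure B] [FunLike F A B] [HomClass modalLang F A B] (f : F)

theorem map_inf (a b : A) : f (inf a b) = inf (f a) (f b) := by
  simpa using (HomClass.realize_term f (v := ![a, b])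
    (t := infTerm (Term.var 0) (Term.var 1))).symm

theorem map_boxdot (a : A) : f (boxdot a) = boxdot (f a) := by
  simpa using (HomClass.realize_term f (v := ![a]) (t := boxdotTerm (Term.var 0))).symm

end ModalTerms

/-- The equations defining modal algebras. -/
def modalEquations : Set (Equation modalLang ℕ) :=
  let x := Term.var 0
  let y := Term.var 1
  let z := Term.var 2
  {(infTerm x y, infTerm y x), (infTerm (infTerm x y) z, infTerm x (infTerm y z)),
    (supTerm x y, supTerm y x), (supTerm (supTerm x y) z, supTerm x (supTerm y z)),
    (infTerm x (supTerm x y), x), (supTerm x (infTerm x y), x),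
    (infTerm x (supTerm y z), supTerm (infTerm x y) (infTerm x z)),
    (supTerm x botTerm, x), (infTerm x topTerm, x),
    (infTerm x (complTerm x), botTerm), (supTerm x (complTerm x), topTerm),
    (boxTerm topTerm, topTerm), (boxTerm (infTerm x y), infTerm (boxTerm x) (boxTerm y))}

theorem mem_equationalClass_modalEquations (A : Bundled.{u} modalLang.Structure) :
    A ∈ equationalClass modalEquations ↔ IsModalAlgebra A := by
  constructor
  · intro h
    have key : ∀ e ∈ modalEquations, ∀ a b c : A,
        e.Holds (fun n : ℕ => match n with | 0 => a | 1 => b | _ => c) := fun e he a b c => h e he _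
    simp only [modalEquations, Set.mem_insert_iff, Set.mem_singleton_iff, forall_eq_or_imp,
      forall_eq, Equation.Holds, realize_infTerm, realize_supTerm, realize_boxTerm,
      realize_complTerm, realize_botTerm, realize_topTerm, Term.realize_var] at key
    obtain ⟨h1, h2, h3, h4, h5, h6, h7, h8, h9, h10, h11, h12, h13⟩ := key
    exact ⟨fun a b => h1 a b a, h2, fun a b => h3 a b a, h4, fun a b => h5 a b a,
      fun a b => h6 a b a, h7, fun a => h8 a a a, fun a => h9 a a a, fun a => h10 a a a,
      fun a => h11 a a a, h12 bot bot bot, fun a b => h13 a b a⟩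
  · rintro ⟨h1, h2, h3, h4, h5, h6, h7, h8, h9, h10, h11, h12, h13⟩ e he v
    simp only [modalEquations, Set.mem_insert_iff, Set.mem_singleton_iff] at he
    rcases he with rfl | rfl | rfl | rfl | rfl | rfl | rfl | rfl | rfl | rfl | rfl | rfl | rfl <;>
      simp only [Equation.Holds, realize_infTerm, realize_supTerm, realize_boxTerm,
        realize_complTerm, realize_botTerm, realize_topTerm, Term.realize_var]
    exacts [h1 _ _, h2 _ _ _, h3 _ _, h4 _ _ _, h5 _ _, h6 _ _, h7 _ _ _, h8 _, h9 _, h10 _,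
      h11 _, h12, h13 _ _]

theorem IsModalVariety.exists_eq_equationalClass {V : Set (Bundled.{u} modalLang.Structure)}
    (hV : IsModalVariety V) : ∃ E, V = equationalClass.{u} E := by
  obtain ⟨E, rfl⟩ := hV
  refine ⟨modalEquations ∪ E, Set.ext fun A => ?_⟩
  change IsModalAlgebra A ∧ _ ↔ _
  rw [← mem_equationalClass_modalEquations]
  simp only [equationalClass, Set.mem_ofPred_eq, Set.mem_union, or_imp, forall_and]

theorem IsModalVariety.isModalAlgebra {V : Set (Bundled.{u} modalLang.Structure)}
    (hV : IsModalVariety V) {A : Bundled.{u} modalLang.Structure} (hA : A ∈ V) :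
    IsModalAlgebra A := by
  obtain ⟨E, rfl⟩ := hV
  exact hA.1

/-! ### The order of a modal algebra -/

namespace IsModalAlgebra

variable {A : Type u} [modalLang.Structure A] (h : IsModalAlgebra A)
include h

theorem inf_le_left' (a b : A) : inf (inf a b) a = inf a b := by
  let _ := h.toPartialOrder
  rw [h.inf_comm a b, h.inf_assoc, show inf a a = a from le_refl a]

theorem inf_le_right' (a b : A) : inf (inf a b) b = inf a b := by
  rw [h.inf_comm a b, h.inf_le_left']

theorem le_inf' {a b c : A} (hb : inf a b = a) (hc : inf a c = a) : inf a (inf b c) = a := by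
  rw [← h.inf_assoc, hb, hc]

theorem le_trans' {a b c : A} (hab : inf a b = a) (hbc : inf b c = b) : inf a c = a := by
  rw [← hab, h.inf_assoc, hbc]

theorem box_mono {a b : A} (hab : inf a b = a) : inf (box a) (box b) = box a := by
  rw [← h.box_inf, hab]

theorem boxdot_le (a : A) : inf (boxdot a) a = boxdot a := h.inf_le_right' _ _

theorem boxdot_mono {a b : A} (hab : inf a b = a) : inf (boxdot a) (boxdot b) = boxdot a :=
  h.le_inf' (h.le_trans' (h.inf_le_left' _ _) (h.box_mono hab))
    (h.le_trans' (h.inf_le_right' _ _) hab)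

theorem iterate_boxdot_le (a : A) {k n : ℕ} (hkn : k ≤ n) :
    inf (boxdot^[n] a) (boxdot^[k] a) = boxdot^[n] a := by
  let _ := h.toPartialOrder
  induction n, hkn using Nat.le_induction with
  | base => exact le_refl (boxdot^[k] a)
  | succ n hn ih =>
    rw [Function.iterate_succ_apply']
    exact h.le_trans' (h.boxdot_le _) ih

end IsModalAlgebra

/-! ### Fixpoints of `□x ∧ x` between two elements -/

/-- `x` is a fixpoint of `□x ∧ x` with `y ≤ x ≤ z`. -/
structure IsFixpointBetween {A : Type u} [modalLang.Structure A] (x y z : A) : Prop where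
  lower : inf y x = y
  upper : inf x z = x
  fixed : boxdot x = x

/-- The equations saying that `x` is a fixpoint of `□x ∧ x` with `y ≤ x ≤ z`. -/
def fixpointEquations {α : Type} (x y z : α) : Set (Equation modalLang α) :=
  {(infTerm (Term.var y) (Term.var x), Term.var y),
    (infTerm (Term.var x) (Term.var z), Term.var x), (boxdotTerm (Term.var x), Term.var x)}

theorem finite_fixpointEquations {α : Type} (x y z : α) : (fixpointEquations x y z).Finite := by
  simp [fixpointEquations]

theorem fixpointEquations_hold {A : Type u} [modalLang.Structure A] {α : Type} (x y z : α)
    (v : α → A) :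
    (∀ r ∈ fixpointEquations x y z, r.Holds v) ↔ IsFixpointBetween (v x) (v y) (v z) := by
  simp only [fixpointEquations, Set.mem_insert_iff, Set.mem_singleton_iff, forall_eq_or_imp,
    forall_eq, Equation.Holds, realize_infTerm, realize_boxdotTerm, Term.realize_var]
  exact ⟨fun h => ⟨h.1, h.2.1, h.2.2⟩, fun h => ⟨h.1, h.2, h.3⟩⟩

/-- The equation `y ≤ ⊡ᵏ z`. -/
def approximation (k : ℕ) : Equation modalLang (Fin 2) :=
  (infTerm (Term.var 0) (boxdotTerm^[k] (Term.var 1)), Term.var 0)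

theorem approximation_holds {A : Type u} [modalLang.Structure A] (k : ℕ) (v : Fin 2 → A) :
    (approximation k).Holds v ↔ inf (v 0) (boxdot^[k] (v 1)) = v 0 := by
  simp [approximation, Equation.Holds]

/-- Monotonicity of `⊡` applied to `x ≤ z`, with `x` unchanged by `⊡`. -/
theorem IsFixpointBetween.le_iterate_boxdot {A : Type u} [modalLang.Structure A]
    (h : IsModalAlgebra A) {x y z : A} (hx : IsFixpointBetween x y z) (k : ℕ) :
    inf y (boxdot^[k] z) = y := by
  refine h.le_trans' hx.lower ?_
  induction k with
  | zero => exact hx.upper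
  | succ k ih =>
    rw [Function.iterate_succ_apply']
    have := h.boxdot_mono ih
    rwa [hx.fixed] at this

/-- If `y ≤ ⊡ᵏ z` for all `k`, then some extension within `V` has a fixpoint of `⊡` between `y`
and `z`. -/
def HasFixpointExtensions (V : Set (Bundled.{u} modalLang.Structure)) : Prop :=
  ∀ A ∈ V, ∀ y z : A, (∀ k, inf y (boxdot^[k] z) = y) →
    ∃ B ∈ V, ∃ (j : A ↪[modalLang] B) (c : B), IsFixpointBetween c (j y) (j z)

/-! ### From fixpoint extensions to the three negative conclusions -/

section Criterion

variable {V : Set (Bundled.{u} modalLang.Structure)}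

theorem isWeaklyTransitive_of_approximation (hV : IsModalVariety V) {n : ℕ}
    (h : ∀ A ∈ V, ∀ v : Fin 2 → A, (∀ k ≤ n, (approximation k).Holds v) →
      (approximation (n + 1)).Holds v) : IsWeaklyTransitive V := by
  refine ⟨n, fun A hA a => ?_⟩
  have hM := hV.isModalAlgebra hA
  -- With `y = ⊡ⁿ a` and `z = a` the first `n + 1` conditions hold automatically, and the next one
  -- is the nontrivial half of weak transitivity.
  have h1 := h A hA ![boxdot^[n] a, a] fun k hk =>
    (approximation_holds k _).2 (hM.iterate_boxdot_le a hk)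
  rw [approximation_holds] at h1
  have h2 := hM.iterate_boxdot_le a (Nat.le_succ n)
  rw [← h2, hM.inf_comm]
  exact h1

/-- If the consequences in `y, z` of the existence of a fixpoint of `⊡` between `y` and `z` follow
from finitely many of them, then `V` is weakly transitive. -/
theorem isWeaklyTransitive_of_finite (hV : IsModalVariety V) (hfix : HasFixpointExtensions V)
    {P : Set (Equation modalLang (Fin 2))} (hP : P.Finite)
    (h : ∀ e : Equation modalLang (Fin 2),
      (∀ A ∈ V, ∀ x y z : A, IsFixpointBetween x y z → e.Holds ![y, z]) ↔ Entails V P e) :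
    IsWeaklyTransitive V := by
  obtain ⟨E, hE⟩ := hV.exists_eq_equationalClass
  -- A pair satisfying all approximations acquires a fixpoint in an extension, so it satisfies `P`
  -- there, and equations reflect along embeddings.
  have hPapprox : ∀ r ∈ P, Entails V (Set.range approximation) r := by
    intro r hr A hA v hv
    obtain ⟨B, hB, j, c, hc⟩ := hfix A hA (v 0) (v 1) fun k =>
      (approximation_holds k v).1 (hv _ ⟨k, rfl⟩)
    have h1 := (h r).2 (fun A _ v hv => hv r hr) B hB c _ _ hc
    rw [← Equation.holds_comp_iff j j.injective]
    convert h1 using 1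
    funext i
    fin_cases i <;> rfl
  have hbound : ∃ n, ∀ A ∈ V, ∀ v : Fin 2 → A, (∀ k ≤ n, (approximation k).Holds v) →
      ∀ r ∈ P, r.Holds v := by
    subst hE
    exact exists_bound_of_entails approximation hP hPapprox
  obtain ⟨n, hn⟩ := hbound
  refine isWeaklyTransitive_of_approximation hV (n := n) fun A hA v hv => ?_
  refine (h (approximation (n + 1))).1 ?_ A hA v (hn A hA v hv)
  intro B hB x y z hx
  rw [approximation_holds]
  exact hx.le_iterate_boxdot (hV.isModalAlgebra hB) _

theorem not_isCoherent (hV : IsModalVariety V) (hfix : HasFixpointExtensions V)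
    (hwt : ¬ IsWeaklyTransitive V) : ¬ IsCoherent V := by
  intro hcoh
  obtain ⟨E, rfl⟩ := hV.exists_eq_equationalClass
  obtain ⟨P, hP, h⟩ := hcoh.exists_finite_entails_iff
    (finite_fixpointEquations (0 : Fin 3) 1 2) ![1, 2]
  refine hwt (isWeaklyTransitive_of_finite hV hfix hP fun e => Iff.trans ⟨?_, ?_⟩ (h e))
  · intro H A hA v hv
    rw [Equation.holds_rename]
    convert H A hA _ _ _ ((fixpointEquations_hold _ _ _ v).1 hv) using 1
    funext i
    fin_cases i <;> rfl
  · intro H A hA x y z hx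
    have := H A hA ![x, y, z] ((fixpointEquations_hold _ _ _ _).2 hx)
    rw [Equation.holds_rename] at this
    convert this using 1
    funext i
    fin_cases i <;> rfl

theorem not_admitsRightUniformDeductiveInterpolation (hV : IsModalVariety V)
    (hfix : HasFixpointExtensions V) (hwt : ¬ IsWeaklyTransitive V) :
    ¬ AdmitsRightUniformDeductiveInterpolation V := by
  intro hint
  obtain ⟨P, hP, h⟩ := hint.exists_finite_entails_iff
    (finite_fixpointEquations (Sum.inl 0 : Fin 1 ⊕ Fin 2) (Sum.inr 0) (Sum.inr 1))
  refine hwt (isWeaklyTransitive_of_finite hV hfix hP fun e => Iff.trans ⟨?_, ?_⟩ (h e))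
  · intro H A hA v hv
    rw [Equation.holds_rename]
    convert H A hA _ _ _ ((fixpointEquations_hold _ _ _ v).1 hv) using 1
    funext i
    fin_cases i <;> rfl
  · intro H A hA x y z hx
    have := H A hA (Sum.elim ![x] ![y, z]) ((fixpointEquations_hold _ _ _ _).2 hx)
    rwa [Equation.holds_rename] at this

/-- The formula saying that there is a fixpoint of `⊡` between the two given elements. -/
noncomputable def existsFixpoint : modalLang.Formula (Fin 2) :=
  Formula.iExs (Fin 1)
    (Term.equal (infTerm (Term.var (Sum.inl 0)) (Term.var (Sum.inr 0))) (Term.var (Sum.inl 0)) ⊓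
      (Term.equal (infTerm (Term.var (Sum.inr 0)) (Term.var (Sum.inl 1))) (Term.var (Sum.inr 0)) ⊓
        Term.equal (boxdotTerm (Term.var (Sum.inr 0))) (Term.var (Sum.inr 0))))

theorem realize_existsFixpoint {A : Type u} [modalLang.Structure A] (v : Fin 2 → A) :
    existsFixpoint.Realize v ↔ ∃ c, IsFixpointBetween c (v 0) (v 1) := by
  rw [existsFixpoint, Formula.realize_iExs]
  simp only [Formula.realize_inf, Formula.realize_equal, realize_infTerm, realize_boxdotTerm,
    Term.realize_var, Sum.elim_inl, Sum.elim_inr]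
  exact ⟨fun ⟨i, h⟩ => ⟨i 0, h.1, h.2.1, h.2.2⟩, fun ⟨c, h⟩ => ⟨![c], h.1, h.2, h.3⟩⟩

theorem IsFixpointBetween.map {A B : Type u} [modalLang.Structure A] [modalLang.Structure B]
    (f : A ↪[modalLang] B) {x y z : A} (h : IsFixpointBetween x y z) :
    IsFixpointBetween (f x) (f y) (f z) :=
  ⟨by rw [← map_inf, h.lower], by rw [← map_inf, h.upper], by rw [← map_boxdot, h.fixed]⟩

/-- The model of the theory of `V` given by a member of `V`. -/
def modelOfMem {A : Bundled.{u} modalLang.Structure} (hA : A ∈ V) :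
    Theory.ModelType.{0, 0, u} (theoryOf V) :=
  haveI : A ⊨ theoryOf V := models_theoryOf hA
  haveI : Nonempty A := ⟨bot⟩
  Theory.ModelType.of (theoryOf V) A

/-- In models of `T'` the formula `existsFixpoint` is equivalent to the infinite list of
approximations, while pairs satisfying arbitrarily long but proper initial parts of the list exist.
An ultraproduct of such pairs contradicts Łoś's theorem. -/
theorem not_hasModelCompletion (hV : IsModalVariety V) (hfix : HasFixpointExtensions V)
    (hwt : ¬ IsWeaklyTransitive V) : ¬ HasModelCompletion.{u} (theoryOf V) := by
  rintro ⟨T', hT⟩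
  obtain ⟨E, hE⟩ := hV.exists_eq_equationalClass
  have hfail : ∀ n, ∃ (A : Bundled.{u} modalLang.Structure) (_ : A ∈ V) (v : Fin 2 → A),
      (∀ k ≤ n, (approximation k).Holds v) ∧ ¬ (approximation (n + 1)).Holds v := by
    by_contra! hcon
    obtain ⟨n, hn⟩ := hcon
    exact hwt (isWeaklyTransitive_of_approximation hV hn)
  choose A hA v hv hnv using hfail
  choose N f using fun n => hT.embeds (modelOfMem (hA n))
  let g : ∀ n, A n ↪[modalLang] N n := fun n => (f n).some
  have hfixN : ∀ (M : Theory.ModelType.{0, 0, u} T') (w : Fin 2 → M),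
      existsFixpoint.Realize w ↔ ∀ k, (approximation k).Holds w := by
    intro M w
    obtain ⟨Q, ⟨q⟩⟩ := hT.embeds_base M
    have hQ : Bundled.of (c := modalLang.Structure) Q ∈ V := by
      have hmod := Q.is_model
      subst hE
      exact mem_equationalClass_of_models hmod fun _ _ => ⟨bot⟩
    have hQM : IsModalAlgebra Q := hV.isModalAlgebra hQ
    constructor
    · intro hw k
      obtain ⟨c, hc⟩ := (realize_existsFixpoint w).1 hw
      rw [← Equation.holds_comp_iff q q.injective, approximation_holds]
      exact (hc.map q).le_iterate_boxdot hQM k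
    · intro hw
      -- The chain `M ↪ Q ↪ B ↪ M'` leads from a model of `T'` to another one in which a fixpoint
      -- exists; model completeness brings its existence back to `M`.
      obtain ⟨B, hB, j, c, hc⟩ := hfix _ hQ (q (w 0)) (q (w 1)) fun k => by
        have := (Equation.holds_comp_iff q q.injective).2 (hw k)
        rwa [approximation_holds] at this
      obtain ⟨M', ⟨p⟩⟩ := hT.embeds (modelOfMem hB)
      let p' : B ↪[modalLang] M' := p
      let j' : Q ↪[modalLang] B := j
      refine (hT.model_complete M M' ((p'.comp j').comp q) 2 existsFixpoint w).1 ?_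
      rw [realize_existsFixpoint]
      exact ⟨p' c, IsFixpointBetween.map p' hc⟩
  let U : Ultrafilter ℕ := Filter.hyperfilter ℕ
  let x : Fin 2 → ∀ n, N n := fun i n => g n (v n i)
  have hUT : ((U : Filter ℕ).Product fun n => N n) ⊨ T' := ⟨fun φ hφ =>
    (Ultraproduct.sentence_realize φ).2 (Filter.Eventually.of_forall fun n =>
      (N n).is_model.realize_of_mem φ hφ)⟩
  have hx : ∀ k, (approximation k).Holds
      fun i => (x i : (U : Filter ℕ).Product fun n => N n) := by
    intro k
    rw [Equation.holds_ultraproduct]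
    have : ∀ᶠ n in (U : Filter ℕ), k ≤ n :=
      Nat.hyperfilter_le_atTop (Filter.eventually_ge_atTop k)
    exact this.mono fun n hn => (Equation.holds_comp_iff (g n) (g n).injective).2 (hv n k hn)
  have hreal := (hfixN (Theory.ModelType.of T' ((U : Filter ℕ).Product fun n => N n)) _).2 hx
  -- By Łoś's theorem some factor `N n` has a fixpoint for its own pair, which was chosen to violate
  -- approximation `n + 1`.
  obtain ⟨n, hn⟩ := ((Ultraproduct.realize_formula_cast existsFixpoint x).1 hreal).exists
  exact hnv n ((Equation.holds_comp_iff (g n) (g n).injective).1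
    ((hfixN (N n) (fun i => x i n)).1 hn (n + 1)))

end Criterion

/-! ### Fixpoints in canonical extensions -/

section Sigma

variable {P C : Type u} [CompleteLattice C]

theorem isClosedElt_map (e : P → C) (a : P) : IsClosedElt e (e a) := ⟨{a}, by simp⟩

theorem isOpenElt_map (e : P → C) (a : P) : IsOpenElt e (e a) := ⟨{a}, by simp⟩

/-- The `σ`-extension of an operation extends it. -/
theorem IsCanonicalExtension.sigmaExt_map [PartialOrder P] {e : P → C}
    (he : IsCanonicalExtension e) {n : ℕ} (f : (Fin n → P) → P) (a : Fin n → P) :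
    sigmaExt e f (e ∘ a) = e (f a) := by
  refine le_antisymm (sSup_le ?_) (le_sSup_of_le ⟨e ∘ a, e ∘ a, fun i => isClosedElt_map e _,
    fun i => isOpenElt_map e _, le_rfl, le_rfl, rfl⟩ (le_sInf ?_))
  · rintro _ ⟨p, q, -, -, hp, hq, rfl⟩
    exact sInf_le ⟨a, hp, hq, rfl⟩
  · rintro _ ⟨b, hab, hba, rfl⟩
    have : a = b := funext fun i =>
      le_antisymm ((he.le_iff_le _ _).1 (hab i)) ((he.le_iff_le _ _).1 (hba i))
    rw [this]

end Sigma

/-! ### Meet and box in the canonical extension of a modal algebra -/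

section CanonicalModal

variable {A C : Type u} [modalLang.Structure A] [CompleteLattice C] (h : IsModalAlgebra A)
  {e : A → C} (he : @IsCanonicalExtension A C _ h.toPartialOrder e)
include h he

theorem IsCanonicalExtension.map_le {a b : A} (hab : inf a b = a) : e a ≤ e b := by
  let _ := h.toPartialOrder
  exact (he.le_iff_le a b).2 hab

theorem IsCanonicalExtension.map_top : e top = ⊤ := by
  let _ := h.toPartialOrder
  have h1 := he.map_isGLB ∅ top Set.finite_empty
    ⟨fun _ hx => hx.elim, fun a _ => h.inf_top a⟩
  rw [Set.image_empty, isGLB_empty_iff] at h1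
  exact h1.eq_top

theorem IsCanonicalExtension.map_inf (a b : A) : e (inf a b) = e a ⊓ e b := by
  let _ := h.toPartialOrder
  have h1 := he.map_isGLB {a, b} (inf a b) (by simp) (by
    refine ⟨?_, fun c hc => h.le_inf' (hc (Or.inl rfl)) (hc (Or.inr rfl))⟩
    rintro x (rfl | rfl)
    · exact h.inf_le_left' _ _
    · exact h.inf_le_right' _ _)
  rw [Set.image_pair] at h1
  exact h1.unique isGLB_pair

theorem IsCanonicalExtension.exists_sInf_eq {X : Set A} (hX : X.Finite) :
    ∃ a, sInf (e '' X) = e a := by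
  induction X, hX using Set.Finite.induction_on with
  | empty => exact ⟨top, by rw [Set.image_empty, sInf_empty, he.map_top h]⟩
  | insert _ _ ih =>
    obtain ⟨b, hb⟩ := ih
    exact ⟨inf _ b, by rw [Set.image_insert_eq, sInf_insert, hb, he.map_inf h]⟩

/-- By compactness finitely many of the elements whose meet is `p` already have their meet below
`q`, and that meet comes from `A`. -/
theorem IsCanonicalExtension.exists_between {p q : C} (hp : IsClosedElt e p)
    (hq : IsOpenElt e q) (hpq : p ≤ q) : ∃ a, p ≤ e a ∧ e a ≤ q := by
  let _ := h.toPartialOrder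
  obtain ⟨X, rfl⟩ := hp
  obtain ⟨Y, rfl⟩ := hq
  obtain ⟨X₀, hX₀, Y₀, hY₀, hX₀f, -, hle⟩ := (he.compact (e '' X) (e '' Y)
    (by rintro _ ⟨a, -, rfl⟩; exact isClosedElt_map e a)
    (by rintro _ ⟨a, -, rfl⟩; exact isOpenElt_map e a)).1 hpq
  obtain ⟨X₁, hX₁, hX₁f, rfl⟩ : ∃ X₁ ⊆ X, X₁.Finite ∧ e '' X₁ = X₀ :=
    (Set.exists_subset_image_finite_and (p := fun s => s = X₀)).1 ⟨X₀, hX₀, hX₀f, rfl⟩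
  obtain ⟨a, ha⟩ := he.exists_sInf_eq h hX₁f
  rw [ha] at hle
  exact ⟨a, ha ▸ sInf_le_sInf hX₀, hle.trans (sSup_le_sSup hY₀)⟩

theorem IsCanonicalExtension.isOpenElt_top : IsOpenElt e ⊤ :=
  he.map_top h ▸ isOpenElt_map e top

/-- The operation here is the `σ`-extension, not the lattice meet of `C`. Each inner meet is bounded
by the closed element `p 1`, by testing it against every `e c` above `p 1`. -/
theorem IsCanonicalExtension.sigma_inf_le (x y : C) :
    @inf C (sigmaStructure e) x y ≤ y := by
  refine sSup_le ?_
  rintro _ ⟨p, q, hp, hq, hpx, hxq, rfl⟩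
  obtain ⟨a, hpa, haq⟩ := he.exists_between h (hp 0) (hq 0) ((hpx 0).trans (hxq 0))
  obtain ⟨b, hpb, hbq⟩ := he.exists_between h (hp 1) (hq 1) ((hpx 1).trans (hxq 1))
  refine le_trans ?_ (hpx 1)
  obtain ⟨X, hX⟩ := hp 1
  rw [hX]
  refine le_sInf ?_
  rintro _ ⟨c, hc, rfl⟩
  have hpc : p 1 ≤ e c := hX ▸ sInf_le ⟨c, hc, rfl⟩
  -- Cutting `b` down by `c` keeps the pair between `p` and `q` and brings its meet below `c`.
  refine le_trans (sInf_le ⟨![a, inf b c], ?_, ?_, rfl⟩) ?_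
  · rw [Pi.le_def, Fin.forall_fin_two]
    exact ⟨hpa, (le_inf hpb hpc).trans_eq (he.map_inf h b c).symm⟩
  · rw [Pi.le_def, Fin.forall_fin_two]
    exact ⟨haq, (he.map_le h (h.inf_le_left' b c)).trans hbq⟩
  · exact he.map_le h (h.le_trans' (h.inf_le_right' a (inf b c)) (h.inf_le_right' b c))

theorem IsCanonicalExtension.le_sigma_inf {c x y : C} (hc : IsClosedElt e c) (hx : c ≤ x)
    (hy : c ≤ y) : c ≤ @inf C (sigmaStructure e) x y := by
  refine le_sSup_of_le ⟨fun _ => c, fun _ => ⊤, fun _ => hc, fun _ => he.isOpenElt_top h,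
    ?_, fun _ => le_top, rfl⟩ (le_sInf ?_)
  · rw [Pi.le_def, Fin.forall_fin_two]
    exact ⟨hx, hy⟩
  · rintro _ ⟨a, ha, -, rfl⟩
    have : a = ![a 0, a 1] := by
      funext i
      fin_cases i <;> rfl
    rw [this]
    exact (le_inf (ha 0) (ha 1)).trans_eq (he.map_inf h _ _).symm

/-- Commutativity in `C` turns the bound of `sigma_inf_le` by the second argument into one by the
first. -/
theorem IsCanonicalExtension.sigma_inf_eq {x y : C}
    (hC : @IsModalAlgebra C (sigmaStructure e)) (hx : IsClosedElt e x) (hxy : x ≤ y) :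
    @inf C (sigmaStructure e) x y = x := by
  refine le_antisymm ?_ (he.le_sigma_inf h hx le_rfl hxy)
  let _ := sigmaStructure e
  rw [hC.inf_comm]
  exact he.sigma_inf_le h y x

/-- In the canonical extension, the meet of the elements `⊡ᵏ z` lies below its own image
under `□`. -/
theorem IsCanonicalExtension.le_sigma_box (z : A) :
    sInf (e '' Set.range fun k => boxdot^[k] z) ≤
      @box C (sigmaStructure e) (sInf (e '' Set.range fun k => boxdot^[k] z)) := by
  let _ := h.toPartialOrder
  set c := sInf (e '' Set.range fun k => boxdot^[k] z) with hc
  have hcc : IsClosedElt e c := ⟨_, hc⟩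
  refine le_sSup_of_le ⟨fun _ => c, fun _ => ⊤, fun _ => hcc, fun _ => he.isOpenElt_top h,
    ?_, fun _ => le_top, rfl⟩ (le_sInf ?_)
  · intro i
    fin_cases i
    exact le_rfl
  rintro _ ⟨a, ha, -, rfl⟩
  have hbox : Structure.funMap (L := modalLang) ModalOp.box a = box (a 0) := by
    refine congrArg (Structure.funMap (L := modalLang) ModalOp.box) (funext fun i => ?_)
    fin_cases i
    rfl
  rw [hbox]
  -- Written as a join of one element so that compactness applies.
  have hca : sInf (e '' Set.range fun k => boxdot^[k] z) ≤ sSup {e (a 0)} := by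
    rw [sSup_singleton]
    exact ha 0
  obtain ⟨X₀, hX₀, Y₀, hY₀, hX₀f, -, hle⟩ := (he.compact _ {e (a 0)}
    (by rintro _ ⟨a, -, rfl⟩; exact isClosedElt_map e a)
    (by rintro _ rfl; exact isOpenElt_map e _)).1 hca
  -- The iterates descend, so finitely many of them are all bounded below by a single one.
  have hbound : ∃ n, e (boxdot^[n] z) ≤ sInf X₀ := by
    clear hle
    induction X₀, hX₀f using Set.Finite.induction_on with
    | empty => exact ⟨0, by simp⟩
    | insert _ _ ih =>
      rw [Set.insert_subset_iff] at hX₀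
      obtain ⟨⟨_, ⟨k, rfl⟩, rfl⟩, hX₀⟩ := hX₀
      obtain ⟨n, hn⟩ := ih hX₀
      refine ⟨max k n, ?_⟩
      rw [sInf_insert]
      exact le_inf (he.map_le h (h.iterate_boxdot_le z (le_max_left _ _)))
        ((he.map_le h (h.iterate_boxdot_le z (le_max_right _ _))).trans hn)
  obtain ⟨n, hn⟩ := hbound
  have hna : e (boxdot^[n] z) ≤ e (a 0) :=
    hn.trans (hle.trans ((sSup_le_sSup hY₀).trans_eq sSup_singleton))
  have hna' : inf (boxdot^[n] z) (a 0) = boxdot^[n] z := (he.le_iff_le _ _).1 hna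
  -- One further iterate supplies the box: `c ≤ ⊡ⁿ⁺¹ z ≤ □ ⊡ⁿ z ≤ □ (a 0)`.
  have hcn : c ≤ e (boxdot^[n + 1] z) := sInf_le ⟨_, ⟨n + 1, rfl⟩, rfl⟩
  refine hcn.trans (he.map_le h ?_)
  rw [Function.iterate_succ_apply']
  exact h.le_trans' (h.inf_le_left' _ _) (h.box_mono hna')

end CanonicalModal

theorem ClosedUnderCanonicalExtensions.hasFixpointExtensions
    {V : Set (Bundled.{u} modalLang.Structure)} (hV : IsModalVariety V)
    (hcan : ClosedUnderCanonicalExtensions V) : HasFixpointExtensions V := by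
  intro A hA y z hyz
  have h := hV.isModalAlgebra hA
  obtain ⟨C, _, e, he, hC⟩ := hcan A hA h
  have hCM : @IsModalAlgebra C (sigmaStructure e) := hV.isModalAlgebra hC
  let _ := h.toPartialOrder
  let _ := sigmaStructure e
  let j : A ↪[modalLang] C :=
    { toFun := e
      inj' := fun a b hab => le_antisymm
        ((he.le_iff_le a b).1 hab.le) ((he.le_iff_le b a).1 hab.ge)
      map_fun' := fun f x => (he.sigmaExt_map (Structure.funMap f) x).symm
      map_rel' := fun r _ => Empty.elim r }
  -- The greatest candidate: every fixpoint below `z` lies below all iterates. Being closed, it is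
  -- within reach of the bounds on the extended meet.
  set c := sInf (e '' Set.range fun k => boxdot^[k] z) with hc
  have hcc : IsClosedElt e c := ⟨_, hc⟩
  refine ⟨⟨C, sigmaStructure e⟩, hC, j, c, ?_, ?_, ?_⟩
  · refine he.sigma_inf_eq h hCM (isClosedElt_map e y) (le_sInf ?_)
    rintro _ ⟨_, ⟨k, rfl⟩, rfl⟩
    exact he.map_le h (hyz k)
  · exact he.sigma_inf_eq h hCM hcc (sInf_le ⟨_, ⟨0, rfl⟩, rfl⟩)
  · exact le_antisymm (he.sigma_inf_le h _ _) (he.le_sigma_inf h hcc (he.le_sigma_box h z) le_rfl)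

/-! ### Complex algebras of Kripke frames -/

section ComplexAlgebra

/-- The modal operations on the subsets of a Kripke frame. -/
def complexOp {X : Type u} (R : X → X → Prop) : ∀ {n : ℕ}, ModalOp n → (Fin n → Set X) → Set X
  | _, ModalOp.bot, _ => ∅
  | _, ModalOp.top, _ => Set.univ
  | _, ModalOp.compl, s => (s 0)ᶜ
  | _, ModalOp.box, s => {w | ∀ v, R w v → v ∈ s 0}
  | _, ModalOp.inf, s => s 0 ∩ s 1
  | _, ModalOp.sup, s => s 0 ∪ s 1

/-- The complex algebra of a Kripke frame. -/
@[reducible]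
def complexStructure {X : Type u} (R : X → X → Prop) : modalLang.Structure (Set X) where
  funMap f s := complexOp R f s
  RelMap r _ := Empty.elim r

/-- The complex algebra of a Kripke frame, bundled. -/
def complexAlgebra {X : Type u} (R : X → X → Prop) : Bundled.{u} modalLang.Structure :=
  ⟨Set X, complexStructure R⟩

variable {X : Type u} (R : X → X → Prop)

theorem isModalAlgebra_complexAlgebra : @IsModalAlgebra (Set X) (complexStructure R) :=
  let _ := complexStructure R
  { inf_comm := fun a b => Set.inter_comm a b
    inf_assoc := fun a b c => Set.inter_assoc a b c
    sup_comm := fun a b => Set.union_comm a b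
    sup_assoc := fun a b c => Set.union_assoc a b c
    inf_sup_self := fun a b => inf_sup_self (a := a) (b := b)
    sup_inf_self := fun a b => sup_inf_self (a := a) (b := b)
    inf_sup_left := fun a b c => Set.inter_union_distrib_left a b c
    sup_bot := fun a => Set.union_empty a
    inf_top := fun a => Set.inter_univ a
    inf_compl := fun a => Set.inter_compl_self a
    sup_compl := fun a => Set.union_compl_self a
    box_top := Set.eq_univ_of_forall fun _ _ _ => trivial
    box_inf := fun _ _ => Set.ext fun _ =>
      ⟨fun h => ⟨fun v hv => (h v hv).1, fun v hv => (h v hv).2⟩,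
        fun h v hv => ⟨h.1 v hv, h.2 v hv⟩⟩ }

theorem complexAlgebra_mem_varietyK : complexAlgebra R ∈ varietyK :=
  isModalAlgebra_complexAlgebra R

theorem complexAlgebra_mem_varietyKT (hR : ∀ w, R w w) : complexAlgebra R ∈ varietyKT :=
  ⟨isModalAlgebra_complexAlgebra R, fun _ => Set.inter_eq_left.2 fun w hw => hw w (hR w)⟩

/-- The reflexive frame on `ℕ` in which `i` sees `i + 1`. -/
def stepRel (i j : ULift.{u} ℕ) : Prop := j.down = i.down ∨ j.down = i.down + 1

/-- Each application of `⊡` removes the last point of an initial segment, since that point sees its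
successor outside. -/
theorem iterate_boxdot_stepRel (m k : ℕ) :
    (@boxdot _ (complexStructure stepRel.{u}))^[k] {i | i.down < m} = {i | i.down + k < m} := by
  induction k with
  | zero => rfl
  | succ k ih =>
    rw [Function.iterate_succ_apply', ih]
    ext i
    change (∀ j : ULift ℕ, stepRel i j → j.down + k < m) ∧ i.down + k < m ↔ i.down + (k + 1) < m
    constructor
    · rintro ⟨h, -⟩
      have := h ⟨i.down + 1⟩ (Or.inr rfl)
      simp only at this
      omega
    · intro h
      refine ⟨?_, by omega⟩
      rintro j (hj | hj) <;> omega

theorem not_isWeaklyTransitive_of_stepRel {V : Set (Bundled.{u} modalLang.Structure)}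
    (h : complexAlgebra stepRel.{u} ∈ V) : ¬ IsWeaklyTransitive V := by
  rintro ⟨n, hn⟩
  -- The segment has `n + 1` points: `0` survives `n` applications, and nothing survives one more.
  have h1 : (@boxdot _ (complexStructure stepRel.{u}))^[n + 1] {i | i.down < n + 1} =
      (@boxdot _ (complexStructure stepRel.{u}))^[n] {i | i.down < n + 1} := hn _ h _
  rw [iterate_boxdot_stepRel, iterate_boxdot_stepRel] at h1
  have h2 : (⟨0⟩ : ULift.{u} ℕ) ∈ {i : ULift.{u} ℕ | i.down + n < n + 1} := by simp
  rw [← h1] at h2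
  simp at h2

end ComplexAlgebra

/-! ### Ultrafilters of a modal algebra -/

section Ultrafilters

variable (A : Type u) [modalLang.Structure A]

/-- The ultrafilters of the Boolean reduct of a modal algebra. -/
structure ModalUltrafilter where
  carrier : Set A
  bot_notMem : bot ∉ carrier
  top_mem : top ∈ carrier
  compl_mem : ∀ a, compl a ∈ carrier ↔ a ∉ carrier
  inf_mem : ∀ a b, inf a b ∈ carrier ↔ a ∈ carrier ∧ b ∈ carrier
  sup_mem : ∀ a b, sup a b ∈ carrier ↔ a ∈ carrier ∨ b ∈ carrier

/-- The accessibility relation between ultrafilters. -/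
def ModalUltrafilter.rel (w v : ModalUltrafilter A) : Prop :=
  ∀ a, box a ∈ w.carrier → a ∈ v.carrier

variable {A}

/-- The distributive lattice underlying a modal algebra. -/
@[reducible]
def IsModalAlgebra.toDistribLattice (h : IsModalAlgebra A) : DistribLattice A :=
  let l : Lattice A :=
    { h.toPartialOrder with
      inf := inf
      sup := sup
      le_sup_left := h.inf_sup_self
      le_sup_right := fun a b => by
        change inf b (sup a b) = b
        rw [h.sup_comm, h.inf_sup_self]
      sup_le := fun a b c (hac : inf a c = a) (hbc : inf b c = b) => by
        change inf (sup a b) c = sup a b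
        rw [h.inf_comm, h.inf_sup_left, h.inf_comm c a, h.inf_comm c b, hac, hbc]
      inf_le_left := h.inf_le_left'
      inf_le_right := h.inf_le_right'
      le_inf := fun _ _ _ => h.le_inf' }
  DistribLattice.ofInfSupLe (α := A) fun a b c => (h.inf_sup_left a b c).le

/-- A filter that omits `a` extends to an ultrafilter that omits `a`. -/
theorem IsModalAlgebra.exists_ultrafilter (h : IsModalAlgebra A) {F : Set A} (htop : top ∈ F)
    (hinf : ∀ a ∈ F, ∀ b ∈ F, inf a b ∈ F) (hmono : ∀ a b, inf a b = a → a ∈ F → b ∈ F)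
    {a : A} (ha : a ∉ F) :
    ∃ w : ModalUltrafilter A, F ⊆ w.carrier ∧ a ∉ w.carrier := by
  let _ := h.toDistribLattice
  have hF : Order.IsPFilter F := Order.IsPFilter.of_def ⟨top, htop⟩
    (fun b hb c hc => ⟨inf b c, hinf b hb c hc, h.inf_le_left' b c, h.inf_le_right' b c⟩)
    fun {b c} hbc hb => hmono b c hbc hb
  -- The ultrafilter is the complement of a prime ideal that contains `a` and avoids `F`.
  obtain ⟨J, hJ, haJ, hdisj⟩ := DistribLattice.prime_ideal_of_disjoint_filter_ideal
    (F := hF.toPFilter) (I := Order.Ideal.principal a) (by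
      rw [Set.disjoint_left]
      exact fun b hb hba => ha (hmono b a hba hb))
  have hFJ : ∀ b ∈ F, b ∉ J := fun b hb => Set.disjoint_left.1 hdisj hb
  have hbot : bot ∈ J := J.lower (show bot ≤ a by
    change inf bot a = bot
    rw [← h.inf_compl a, h.inf_le_left']) (haJ Order.Ideal.mem_principal_self)
  have hinfJ : ∀ b c, inf b c ∈ J ↔ b ∈ J ∨ c ∈ J := fun b c =>
    ⟨hJ.mem_or_mem, fun hbc => hbc.elim (fun hb => J.lower (h.inf_le_left' b c) hb)
      fun hc => J.lower (h.inf_le_right' b c) hc⟩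
  have hsupJ : ∀ b c, sup b c ∈ J ↔ b ∈ J ∧ c ∈ J := fun b c => Order.Ideal.sup_mem_iff
  refine ⟨⟨{b | b ∉ J}, fun hb => hb hbot, hFJ _ htop, fun b => ?_, fun b c => ?_, fun b c => ?_⟩,
    hFJ, fun hb => hb (haJ Order.Ideal.mem_principal_self)⟩
  · have h1 : b ∈ J ∨ compl b ∈ J := (hinfJ _ _).1 (by rwa [h.inf_compl])
    have h2 : ¬ (b ∈ J ∧ compl b ∈ J) := fun hb => hFJ _ htop (by
      rw [← h.sup_compl b]
      exact (hsupJ _ _).2 hb)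
    simp only [Set.mem_ofPred_eq]
    tauto
  · simp only [Set.mem_ofPred_eq, hinfJ, not_or]
  · simp only [Set.mem_ofPred_eq, hsupJ]
    tauto

theorem ModalUltrafilter.mem_of_le (w : ModalUltrafilter A) {a b : A} (hab : inf a b = a)
    (ha : a ∈ w.carrier) : b ∈ w.carrier :=
  ((w.inf_mem a b).1 (hab.symm ▸ ha)).2

/-- The sets of ultrafilters representing the elements of a modal algebra. -/
def stoneSet (a : A) : Set (ModalUltrafilter A) := {w | a ∈ w.carrier}

theorem IsModalAlgebra.le_of_stoneSet_subset (h : IsModalAlgebra A) {a b : A}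
    (hab : stoneSet a ⊆ stoneSet b) : inf a b = a := by
  by_contra hne
  obtain ⟨w, hFw, hbw⟩ := h.exists_ultrafilter (F := {c | inf a c = a}) (h.inf_top a)
    (fun _ hb _ hc => h.le_inf' hb hc) (fun _ _ hbc hb => h.le_trans' hb hbc) hne
  have : inf a a = a := h.toPartialOrder.le_refl a
  exact hbw (hab (hFw this))

theorem IsModalAlgebra.stoneSet_box (h : IsModalAlgebra A) (a : A) :
    stoneSet (box a) = {w | ∀ v, ModalUltrafilter.rel A w v → v ∈ stoneSet a} := by
  -- For the converse, the elements whose box lies in `w` form a filter. If it omits `a`, it extends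
  -- to a successor of `w` omitting `a`.
  refine Set.Subset.antisymm (fun w hw v hv => hv a hw) fun w hw => ?_
  by_contra hne
  obtain ⟨v, hFv, hav⟩ := h.exists_ultrafilter (F := {c | box c ∈ w.carrier})
    (by rw [Set.mem_ofPred_eq, h.box_top]; exact w.top_mem)
    (fun b hb c hc => by
      rw [Set.mem_ofPred_eq, h.box_inf]
      exact (w.inf_mem _ _).2 ⟨hb, hc⟩)
    (fun b c hbc hb => w.mem_of_le (h.box_mono hbc) hb) hne
  exact hav (hw v fun c hc => hFv hc)

/-- The embedding of a modal algebra into the complex algebra of its ultrafilter frame. -/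
def IsModalAlgebra.stoneEmbedding {A : Bundled.{u} modalLang.Structure} (h : IsModalAlgebra A) :
    A ↪[modalLang] (complexAlgebra (ModalUltrafilter.rel A)) :=
  let _ := complexStructure (ModalUltrafilter.rel A)
  { toFun := stoneSet
    inj' := fun a b hab => h.toPartialOrder.le_antisymm a b
      (h.le_of_stoneSet_subset (subset_of_eq hab)) (h.le_of_stoneSet_subset (subset_of_eq hab.symm))
    map_fun' := by
      rintro n f x
      cases f with
      | bot =>
        rw [Subsingleton.elim x (![] : Fin 0 → A)]
        exact Set.eq_empty_of_forall_notMem fun w hw => w.bot_notMem hw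
      | top =>
        rw [Subsingleton.elim x (![] : Fin 0 → A)]
        exact Set.eq_univ_of_forall fun w => w.top_mem
      | compl =>
        rw [show x = (![x 0] : Fin 1 → A) from funext fun i => by fin_cases i; rfl]
        exact Set.ext fun w => w.compl_mem _
      | box =>
        rw [show x = (![x 0] : Fin 1 → A) from funext fun i => by fin_cases i; rfl]
        exact h.stoneSet_box _
      | inf =>
        rw [show x = (![x 0, x 1] : Fin 2 → A) from funext fun i => by fin_cases i <;> rfl]
        exact Set.ext fun w => w.inf_mem _ _
      | sup =>
        rw [show x = (![x 0, x 1] : Fin 2 → A) from funext fun i => by fin_cases i <;> rfl]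
        exact Set.ext fun w => w.sup_mem _ _
    map_rel' := fun r _ => Empty.elim r }

/-- The intersection of the sets representing `⊡ᵏ z` is a fixpoint: an ultrafilter `w` in it
contains `⊡ᵏ⁺¹ z`, hence `□ ⊡ᵏ z`, for all `k`, so each successor of `w` contains every `⊡ᵏ z`. -/
theorem hasFixpointExtensions_of_complexAlgebra {V : Set (Bundled.{u} modalLang.Structure)}
    (hV : ∀ A ∈ V, IsModalAlgebra A ∧ complexAlgebra (ModalUltrafilter.rel A) ∈ V) :
    HasFixpointExtensions V := by
  intro A hA y z hyz
  obtain ⟨h, hC⟩ := hV A hA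
  let c : Set (ModalUltrafilter A) := ⋂ k : ℕ, stoneSet (boxdot^[k] z)
  refine ⟨_, hC, h.stoneEmbedding, c, ?_, ?_, ?_⟩
  · exact Set.inter_eq_left.2 (Set.subset_iInter fun k w hw => w.mem_of_le (hyz k) hw)
  · exact Set.inter_eq_left.2 (Set.iInter_subset _ 0)
  · refine Set.inter_eq_right.2 fun w hw v hv => Set.mem_iInter.2 fun k => hv _ ?_
    have hk := Set.mem_iInter.1 hw (k + 1)
    rw [Function.iterate_succ_apply'] at hk
    exact ((w.inf_mem _ _).1 hk).1

end Ultrafilters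

/-! ### The varieties of K and KT, and the conclusion -/

theorem isModalVariety_varietyK : IsModalVariety varietyK.{u} :=
  ⟨∅, Set.ext fun _ => ⟨fun h => ⟨h, fun _ he => he.elim⟩, fun h => h.1⟩⟩

theorem isModalVariety_varietyKT : IsModalVariety varietyKT.{u} := by
  refine ⟨{(infTerm (boxTerm (Term.var 0)) (Term.var 0), boxTerm (Term.var 0))}, Set.ext fun A => ?_⟩
  simp only [varietyKT, Set.mem_ofPred_eq, Set.mem_singleton_iff, forall_eq, Equation.Holds,
    realize_infTerm, realize_boxTerm, Term.realize_var]
  exact and_congr_right fun _ => ⟨fun h v => h (v 0), fun h a => h fun _ => a⟩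

theorem hasFixpointExtensions_varietyK : HasFixpointExtensions varietyK.{u} :=
  hasFixpointExtensions_of_complexAlgebra fun _ hA => ⟨hA, complexAlgebra_mem_varietyK _⟩

theorem hasFixpointExtensions_varietyKT : HasFixpointExtensions varietyKT.{u} :=
  hasFixpointExtensions_of_complexAlgebra fun _ hA => ⟨hA.1,
    -- The identity `□a ≤ a` makes the ultrafilter frame reflexive.
    complexAlgebra_mem_varietyKT _ fun w a ha => w.mem_of_le (hA.2 a) ha⟩

theorem not_coherent_interpolation_modelCompletion {V : Set (Bundled.{u} modalLang.Structure)}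
    (hV : IsModalVariety V) (hfix : HasFixpointExtensions V) (hwt : ¬ IsWeaklyTransitive V) :
    ¬ IsCoherent V ∧ ¬ AdmitsRightUniformDeductiveInterpolation V ∧
      ¬ HasModelCompletion.{u} (theoryOf V) :=
  ⟨not_isCoherent hV hfix hwt, not_admitsRightUniformDeductiveInterpolation hV hfix hwt,
    not_hasModelCompletion hV hfix hwt⟩

end ModalCoherence

theorem corollary5p4 :
    (∀ V : Set (CategoryTheory.Bundled.{u} ModalCoherence.modalLang.Structure),
      ModalCoherence.IsModalVariety V →
      ModalCoherence.ClosedUnderCanonicalExtensions V →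
      ¬ ModalCoherence.IsWeaklyTransitive V →
        ¬ ModalCoherence.IsCoherent V ∧
        ¬ ModalCoherence.AdmitsRightUniformDeductiveInterpolation V ∧
        ¬ ModalCoherence.HasModelCompletion.{u} (ModalCoherence.theoryOf V)) ∧
    (¬ ModalCoherence.IsCoherent ModalCoherence.varietyK.{u} ∧
      ¬ ModalCoherence.AdmitsRightUniformDeductiveInterpolation ModalCoherence.varietyK.{u} ∧
      ¬ ModalCoherence.HasModelCompletion.{u}
        (ModalCoherence.theoryOf ModalCoherence.varietyK.{u})) ∧
    (¬ ModalCoherence.IsCoherent ModalCoherence.varietyKT.{u} ∧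
      ¬ ModalCoherence.AdmitsRightUniformDeductiveInterpolation ModalCoherence.varietyKT.{u} ∧
      ¬ ModalCoherence.HasModelCompletion.{u}
        (ModalCoherence.theoryOf ModalCoherence.varietyKT.{u})) := by
  open ModalCoherence in
  exact ⟨fun V hV hcan hwt =>
      not_coherent_interpolation_modelCompletion hV (hcan.hasFixpointExtensions hV) hwt,
    not_coherent_interpolation_modelCompletion isModalVariety_varietyK
      hasFixpointExtensions_varietyK
      (not_isWeaklyTransitive_of_stepRel (complexAlgebra_mem_varietyK _)),
    not_coherent_interpolation_modelCompletion isModalVariety_varietyKT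
      hasFixpointExtensions_varietyKT (not_isWeaklyTransitive_of_stepRel
        (complexAlgebra_mem_varietyKT _ fun _ => Or.inl rfl))⟩
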